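/- Let $H$ be a finite multigraph (parallel edges and loops allowed, a loop contributing $2$ to the degree of its vertex) that is cubic, i.e. every vertex has degree $3$, and $2$-edge-connected, i.e. it has at least two vertices, and it is connected and stays connected after the removal of any single edge. Let $S_2$ denote the multigraph consisting of two vertices joined by three parallel edges. If $H$ is not isomorphic to $S_2$, $K_4$ or $K_{3,3}$, then $H$ is decomposable; that is, $H$ has a separating matching: a set $M$ of pairwise non-adjacent non-loop edges such that $H - M$ has more connected components than $H$. -/

import Mathlib

open scoped Graph

namespace Graph

/-- The degree of a vertex of a multigraph: the number of incident edges, loops counted twice. -/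
noncomputable def edegree {α β : Type*} (G : Graph α β) (x : α) : ℕ∞ :=
  (G.incidenceSet x).encard + (G.loopSet x).encard

/-- Every vertex has degree three. -/
def IsCubic {α β : Type*} (G : Graph α β) : Prop :=
  ∀ x ∈ V(G), G.edegree x = 3

/-- `y` can be reached from `x` along a walk (possibly of length zero). -/
def Reachable {α β : Type*} (G : Graph α β) (x y : α) : Prop :=
  Relation.ReflTransGen G.Adj x y

/-- A connected multigraph is nonempty and any two vertices are joined by a walk. -/
def IsConnected {α β : Type*} (G : Graph α β) : Prop :=
  V(G).Nonempty ∧ ∀ x ∈ V(G), ∀ y ∈ V(G), G.Reachable x y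

/-- The connected components, given by their vertex sets. -/
def components {α β : Type*} (G : Graph α β) : Set (Set α) :=
  {C | ∃ x ∈ V(G), C = {y | G.Reachable x y}}

/-- `k`-edge-connected: more than one vertex, and the graph stays connected when fewer
than `k` edges are deleted. -/
def IsEdgeConnected {α β : Type*} (G : Graph α β) (k : ℕ) : Prop :=
  V(G).Nontrivial ∧
    ∀ F : Set β, F ⊆ E(G) → F.encard < (k : ℕ∞) → (G.deleteEdges F).IsConnected

/-- A matching: a set of edges, none of which is a loop, no two of which share an end. -/
def IsEdgeMatching {α β : Type*} (G : Graph α β) (M : Set β) : Prop :=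
  M ⊆ E(G) ∧
    (∀ e ∈ M, ∀ x, ¬ G.IsLoopAt e x) ∧
    ∀ e ∈ M, ∀ f ∈ M, ∀ x, G.Inc e x → G.Inc f x → e = f

/-- A separating matching: a matching whose removal increases the number of
connected components. -/
def IsSeparatingMatching {α β : Type*} (G : Graph α β) (M : Set β) : Prop :=
  G.IsEdgeMatching M ∧ G.components.encard < (G.deleteEdges M).components.encard

/-- A multigraph is decomposable if it has a separating matching. -/
def IsDecomposable {α β : Type*} (G : Graph α β) : Prop :=
  ∃ M : Set β, G.IsSeparatingMatching M

/-- Isomorphism of multigraphs: bijections between the vertices and between the edges that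
preserve the ends of edges. -/
def IsIsomorphic {α β α' β' : Type*} (G : Graph α β) (H : Graph α' β') : Prop :=
  ∃ (φ : V(G) ≃ V(H)) (ψ : E(G) ≃ E(H)),
    ∀ (e : E(G)) (x y : V(G)), G.IsLink e x y ↔ H.IsLink (ψ e) (φ x) (φ y)

/-- `S₂`: two vertices joined by three parallel edges. -/
def S2 : Graph (Fin 2) (Fin 3) :=
  Graph.banana 0 1 Set.univ

/-- The complete graph on four vertices. -/
def K4 : Graph (Fin 4) (Sym2 (Fin 4)) :=
  Graph.ofSimpleGraph (⊤ : SimpleGraph (Fin 4))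

/-- The complete bipartite graph with three vertices in each class. -/
def K33 : Graph (Fin 3 ⊕ Fin 3) (Sym2 (Fin 3 ⊕ Fin 3)) :=
  Graph.ofSimpleGraph (completeBipartiteGraph (Fin 3) (Fin 3))

end Graph

/-! A set of vertices whose boundary is a matching separates a connected graph, so such a set is
sought around a short cycle. In a cubic graph each vertex of a chordless cycle sends one edge off
it, and the boundary is a matching unless two of these edges share their outer end. On a shortest
cycle such an end closes each of the two arcs with two edges, which forces length at most 4 and
yields a square. Without squares, a shortest cycle therefore suffices
(`exists_isMatchingCut_of_no_square`).

Around a triangle or a square, coinciding outer ends are absorbed and the set grows through a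
diamond or a `K₂,₃`. It may close up to `K₄` or `K₃,₃`; otherwise its boundary is a matching
outright, or consists of two edges that cannot meet because the third edge at their common end would
be a bridge (`isMatchingCut_of_two_edges`). Parallel edges are treated likewise, with `S₂` as the
exception, and loops violate the degree condition; what remains is a simple graph. -/

namespace SimpleGraph

/-! ### Matching cuts in simple cubic graphs -/

variable {V : Type*} {G : SimpleGraph V}

/-- A set of vertices whose edge boundary is a matching separating it from a nonempty
complement. -/
structure IsMatchingCut (G : SimpleGraph V) (A : Set V) : Prop where
  nonempty : A.Nonempty
  compl_nonempty : ∃ y, y ∉ A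
  right_unique : ∀ x ∈ A, ∀ y ∉ A, ∀ z ∉ A, G.Adj x y → G.Adj x z → y = z
  left_unique : ∀ y ∉ A, ∀ x ∈ A, ∀ z ∈ A, G.Adj x y → G.Adj z y → x = z

/-- The neighbours of `x` are precisely the distinct vertices `a`, `b`, `c`. -/
structure HasNeighbors (G : SimpleGraph V) (x a b c : V) : Prop where
  ne₁₂ : a ≠ b
  ne₁₃ : a ≠ c
  ne₂₃ : b ≠ c
  adj_iff : ∀ y, G.Adj x y ↔ y = a ∨ y = b ∨ y = c

/-- Every vertex has exactly three neighbours. -/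
def IsThreeRegular (G : SimpleGraph V) : Prop :=
  ∀ x, ∃ a b c, G.HasNeighbors x a b c

/-- No edge boundary of a nonempty proper set of vertices lies in a single edge. -/
def Bridgeless (G : SimpleGraph V) : Prop :=
  ∀ A : Set V, A.Nonempty → (∃ y, y ∉ A) → ∀ u v, ∃ x ∈ A, ∃ y ∉ A, G.Adj x y ∧ s(x, y) ≠ s(u, v)

theorem IsThreeRegular.exists_third (h : G.IsThreeRegular) {x a b : V} (ha : G.Adj x a)
    (hb : G.Adj x b) (hab : a ≠ b) : ∃ c, G.HasNeighbors x a b c := by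
  obtain ⟨p, q, r, h₁, h₂, h₃, hn⟩ := h x
  rcases (hn a).1 ha with rfl | rfl | rfl <;> rcases (hn b).1 hb with rfl | rfl | rfl
  · exact absurd rfl hab
  · exact ⟨r, hab, h₂, h₃, hn⟩
  · exact ⟨q, hab, h₁, h₃.symm, by grind⟩
  · exact ⟨r, hab, h₃, h₂, by grind⟩
  · exact absurd rfl hab
  · exact ⟨p, hab, h₁.symm, h₂.symm, by grind⟩
  · exact ⟨q, hab, h₃.symm, h₁, by grind⟩
  · exact ⟨p, hab, h₂.symm, h₁.symm, by grind⟩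
  · exact absurd rfl hab

/-- An empty boundary lies in any single edge, so bridgelessness here includes connectedness. -/
theorem Bridgeless.mem_of_closed (h : G.Bridgeless) {A : Set V} (hA : A.Nonempty)
    (hcl : ∀ x ∈ A, ∀ y, G.Adj x y → y ∈ A) (y : V) : y ∈ A := by
  by_contra hy
  obtain ⟨x, hx, z, hz, hxz, -⟩ := h A hA ⟨y, hy⟩ y y
  exact hz (hcl x hx z hxz)

/-- A boundary of two edges with distinct inner ends yields a matching cut: if their outer ends
agree, the third edge there would be a bridge. -/
theorem isMatchingCut_of_two_edges (h3 : G.IsThreeRegular) (hb : G.Bridgeless) {A : Set V}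
    {x y x' y' : V} (hx : x ∈ A) (hy : y ∈ A) (hx' : x' ∉ A) (hy' : y' ∉ A) (hxy : x ≠ y)
    (hxx' : G.Adj x x') (hyy' : G.Adj y y')
    (hA : ∀ u ∈ A, ∀ v ∉ A, G.Adj u v → (u = x ∧ v = x') ∨ (u = y ∧ v = y')) :
    G.IsMatchingCut A := by
  by_cases he : x' = y'
  · subst he
    obtain ⟨t, ht⟩ := h3.exists_third hxx'.symm hyy'.symm hxy
    have htA : t ∉ A := fun hm ↦ by
      have := hA t hm x' hx' ((ht.adj_iff t).2 (by simp)).symm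
      have := ht.ne₁₃
      have := ht.ne₂₃
      grind
    have htx : t ≠ x' := (((ht.adj_iff t).2 (by simp)).ne).symm
    -- Once `x'` is absorbed, both boundary edges of `A` are internal and only `x't` still leaves.
    obtain ⟨u, hu, v, hv, huv, hne⟩ := hb (insert x' A) ⟨x', by simp⟩
      ⟨t, by simp [htA, htx]⟩ x' t
    have := ht.adj_iff v
    have := hA u
    grind
  · exact ⟨⟨x, hx⟩, ⟨x', hx'⟩, by grind, by grind⟩

/-! ### Triangles -/

/-- In the diamond on `a`, `b`, `c`, `w` the vertices `b` and `c` are saturated, so only the third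
edges of the tips `a` and `w` leave it. -/
theorem exists_isMatchingCut_of_diamond (h3 : G.IsThreeRegular) (hb : G.Bridgeless)
    {a b c w a' : V} (hA : G.HasNeighbors a b c a') (hB : G.HasNeighbors b a c w)
    (hC : G.HasNeighbors c a b w) (hw : a' ≠ w) : ∃ A, G.IsMatchingCut A := by
  have hbw : G.Adj b w := (hB.adj_iff w).2 (by simp)
  have hcw : G.Adj c w := (hC.adj_iff w).2 (by simp)
  have haa' : G.Adj a a' := (hA.adj_iff a').2 (by simp)
  obtain ⟨w', hW⟩ := h3.exists_third hbw.symm hcw.symm hA.ne₁₂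
  have hww' : G.Adj w w' := (hW.adj_iff w').2 (by simp)
  obtain ⟨h₁, h₂, h₃, hA⟩ := hA
  obtain ⟨h₄, h₅, h₆, hB⟩ := hB
  obtain ⟨h₇, h₈, h₉, hC⟩ := hC
  obtain ⟨h₁₀, h₁₁, h₁₂, hW⟩ := hW
  have hw'a : w' ≠ a := by
    rintro rfl
    have := (hA w).1 hww'.symm
    grind
  have := haa'.ne
  have := hww'.ne
  exact ⟨{a, b, c, w}, isMatchingCut_of_two_edges h3 hb (x := a) (y := w) (x' := a') (y' := w')
    (by simp) (by simp) (by grind) (by grind) (by grind) haa' hww' (by grind)⟩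

theorem nonempty_iso_top_of_hasNeighbors (hb : G.Bridgeless) {a b c d : V}
    (hA : G.HasNeighbors a b c d) (hB : G.HasNeighbors b a c d) (hC : G.HasNeighbors c a b d)
    (hD : G.HasNeighbors d a b c) : Nonempty (G ≃g (⊤ : SimpleGraph (Fin 4))) := by
  obtain ⟨ha₁, ha₂, ha₃, hA⟩ := hA
  obtain ⟨hb₁, hb₂, hb₃, hB⟩ := hB
  obtain ⟨hc₁, hc₂, hc₃, hC⟩ := hC
  obtain ⟨hd₁, hd₂, hd₃, hD⟩ := hD
  have hmem : ∀ y, y ∈ ({a, b, c, d} : Set V) := hb.mem_of_closed ⟨a, by simp⟩ (by grind)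
  have hf : Function.Bijective ![a, b, c, d] := by
    constructor
    · intro i j hij
      fin_cases i <;> fin_cases j <;> simp_all
    · intro y
      rcases hmem y with rfl | rfl | rfl | rfl
      exacts [⟨0, rfl⟩, ⟨1, rfl⟩, ⟨2, rfl⟩, ⟨3, rfl⟩]
  refine ⟨⟨(Equiv.ofBijective _ hf).symm, ?_⟩⟩
  intro x y
  simp only [top_adj, ne_eq, EmbeddingLike.apply_eq_iff_eq]
  refine ⟨fun h ↦ ?_, fun h ↦ h.ne⟩
  have hx := hmem x
  have hy := hmem y
  simp only [Set.mem_insert_iff, Set.mem_singleton_iff] at hx hy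
  rcases hx with rfl | rfl | rfl | rfl <;> grind

/-- The three outer neighbours decide: all distinct, the triangle itself has a matching boundary;
all equal, the graph is `K₄`; exactly two equal, a diamond appears. -/
theorem exists_isMatchingCut_of_triangle (h3 : G.IsThreeRegular) (hb : G.Bridgeless)
    (hK4 : ¬ Nonempty (G ≃g (⊤ : SimpleGraph (Fin 4)))) {a b c : V}
    (hab : G.Adj a b) (hbc : G.Adj b c) (hca : G.Adj c a) : ∃ A, G.IsMatchingCut A := by
  obtain ⟨a', hA⟩ := h3.exists_third hab hca.symm hbc.ne
  obtain ⟨b', hB⟩ := h3.exists_third hab.symm hbc hca.ne.symm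
  obtain ⟨c', hC⟩ := h3.exists_third hca hbc.symm hab.ne
  by_cases h₁ : b' = c'
  · subst h₁
    by_cases h₂ : a' = b'
    · subst h₂
      have ha : G.Adj a a' := (hA.adj_iff a').2 (by simp)
      have hb' : G.Adj b a' := (hB.adj_iff a').2 (by simp)
      have hc : G.Adj c a' := (hC.adj_iff a').2 (by simp)
      obtain ⟨t, hD⟩ := h3.exists_third ha.symm hb'.symm hab.ne
      obtain rfl : c = t := by
        have := (hD.adj_iff c).1 hc.symm
        have := hca.ne
        have := hbc.ne
        grind
      exact absurd (nonempty_iso_top_of_hasNeighbors hb hA hB hC hD) hK4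
    · exact exists_isMatchingCut_of_diamond h3 hb hA hB hC h₂
  · obtain ⟨ha₁, ha₂, ha₃, hA⟩ := hA
    obtain ⟨hb₁, hb₂, hb₃, hB⟩ := hB
    obtain ⟨hc₁, hc₂, hc₃, hC⟩ := hC
    by_cases h₂ : a' = b'
    · subst h₂
      exact exists_isMatchingCut_of_diamond h3 hb (a := c) (b := a) (c := b) (w := a') (a' := c')
        ⟨by grind, by grind, by grind, by grind⟩ ⟨by grind, by grind, by grind, by grind⟩
        ⟨by grind, by grind, by grind, by grind⟩ (by grind)
    by_cases h₃ : a' = c'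
    · subst h₃
      exact exists_isMatchingCut_of_diamond h3 hb (a := b) (b := a) (c := c) (w := a') (a' := b')
        ⟨by grind, by grind, by grind, by grind⟩ ⟨by grind, by grind, by grind, by grind⟩
        ⟨by grind, by grind, by grind, by grind⟩ (by grind)
    have haa' : G.Adj a a' := (hA a').2 (by simp)
    have := haa'.ne
    refine ⟨{a, b, c}, ⟨a, by simp⟩, ⟨a', by grind⟩, ?_, ?_⟩
    · simp only [Set.mem_insert_iff, Set.mem_singleton_iff]
      rintro x (rfl | rfl | rfl) y hy z hz h h' <;> grind
    · simp only [Set.mem_insert_iff, Set.mem_singleton_iff]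
      rintro y hy x (rfl | rfl | rfl) z (rfl | rfl | rfl) h h' <;> grind

/-! ### Squares in triangle-free graphs -/

/-- The case of a subgraph `K₂,₃` with classes `{a, c}` and `{x, y, z}` in which `x` and `y`
have a further common neighbour. -/
theorem exists_isMatchingCut_of_common (h3 : G.IsThreeRegular) (hb : G.Bridgeless)
    {a c x y z v z' : V} (hA : G.HasNeighbors a x y z) (hC : G.HasNeighbors c x y z)
    (hX : G.HasNeighbors x a c v) (hY : G.HasNeighbors y a c v) (hZ : G.HasNeighbors z a c z')
    (hv : z' ≠ v) (hvz : v ≠ z) (hz'x : z' ≠ x) (hz'y : z' ≠ y) : ∃ A, G.IsMatchingCut A := by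
  have hxv : G.Adj x v := (hX.adj_iff v).2 (by simp)
  have hyv : G.Adj y v := (hY.adj_iff v).2 (by simp)
  have hzz' : G.Adj z z' := (hZ.adj_iff z').2 (by simp)
  have := hzz'.ne
  obtain ⟨v', hV⟩ := h3.exists_third hxv.symm hyv.symm hA.ne₁₂
  have hvv' : G.Adj v v' := (hV.adj_iff v').2 (by simp)
  have := hvv'.ne
  obtain ⟨ha₁, ha₂, ha₃, hA⟩ := hA
  obtain ⟨hc₁, hc₂, hc₃, hC⟩ := hC
  obtain ⟨hx₁, hx₂, hx₃, hX⟩ := hX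
  obtain ⟨hy₁, hy₂, hy₃, hY⟩ := hY
  obtain ⟨hz₁, hz₂, hz₃, hZ⟩ := hZ
  obtain ⟨hv₁, hv₂, hv₃, hV⟩ := hV
  have := hxv.ne
  have := hyv.ne
  have h1 : v' ≠ a := by rintro rfl; have := (hA v).1 hvv'.symm; grind
  have h2 : v' ≠ c := by rintro rfl; have := (hC v).1 hvv'.symm; grind
  have h4 : v' ≠ z := by rintro rfl; have := (hZ v).1 hvv'.symm; grind
  -- The vertices `a`, `c`, `x`, `y` are saturated inside this set, so only `z` and `v` send an edge
  -- out.
  exact ⟨{a, c, x, y, z, v}, isMatchingCut_of_two_edges h3 hb (x := z) (y := v) (x' := z')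
    (y' := v') (by simp) (by simp) (by simp; grind) (by simp; grind) (by grind) hzz' hvv' (by
      simp only [Set.mem_insert_iff, Set.mem_singleton_iff]
      rintro p (rfl | rfl | rfl | rfl | rfl | rfl) q hq h <;> grind)⟩

theorem nonempty_iso_completeBipartiteGraph_of_hasNeighbors (hb : G.Bridgeless)
    {a c x y z v : V} (hA : G.HasNeighbors a x y z) (hC : G.HasNeighbors c x y z)
    (hX : G.HasNeighbors x a c v) (hY : G.HasNeighbors y a c v) (hZ : G.HasNeighbors z a c v)
    (hV : G.HasNeighbors v x y z) :
    Nonempty (G ≃g completeBipartiteGraph (Fin 3) (Fin 3)) := by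
  have hax := ((hA.adj_iff x).2 (by simp)).ne
  have hay := ((hA.adj_iff y).2 (by simp)).ne
  have haz := ((hA.adj_iff z).2 (by simp)).ne
  have hcx := ((hC.adj_iff x).2 (by simp)).ne
  have hcy := ((hC.adj_iff y).2 (by simp)).ne
  have hcz := ((hC.adj_iff z).2 (by simp)).ne
  have hvx := ((hV.adj_iff x).2 (by simp)).ne
  have hvy := ((hV.adj_iff y).2 (by simp)).ne
  have hvz := ((hV.adj_iff z).2 (by simp)).ne
  obtain ⟨ha₁, ha₂, ha₃, hA⟩ := hA
  obtain ⟨-, -, -, hC⟩ := hC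
  obtain ⟨hx₁, hx₂, hx₃, hX⟩ := hX
  obtain ⟨-, -, -, hY⟩ := hY
  obtain ⟨-, -, -, hZ⟩ := hZ
  obtain ⟨-, -, -, hV⟩ := hV
  have hmem : ∀ y', y' ∈ ({a, c, v, x, y, z} : Set V) := hb.mem_of_closed ⟨a, by simp⟩ (by
    simp only [Set.mem_insert_iff, Set.mem_singleton_iff]
    rintro p (rfl | rfl | rfl | rfl | rfl | rfl) q h <;> grind)
  have hf : Function.Bijective (Sum.elim ![a, c, v] ![x, y, z]) := by
    constructor
    · rintro (i | i) (j | j) hij <;> fin_cases i <;> fin_cases j <;> simp_all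
    · intro y'
      rcases hmem y' with rfl | rfl | rfl | rfl | rfl | rfl
      exacts [⟨.inl 0, rfl⟩, ⟨.inl 1, rfl⟩, ⟨.inl 2, rfl⟩, ⟨.inr 0, rfl⟩, ⟨.inr 1, rfl⟩,
        ⟨.inr 2, rfl⟩]
  refine ⟨RelIso.symm ⟨Equiv.ofBijective _ hf, ?_⟩⟩
  rintro (i | i) (j | j) <;> fin_cases i <;> fin_cases j <;> simp [hA, hC, hX, hY, hZ, hV] <;> grind

theorem HasNeighbors.rotate {x a b c : V} (h : G.HasNeighbors x a b c) :
    G.HasNeighbors x b c a :=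
  ⟨h.ne₂₃, h.ne₁₂.symm, h.ne₁₃.symm, fun y ↦ by rw [h.adj_iff]; tauto⟩

/-- Absence of triangles keeps the third neighbours of `x`, `y`, `z` outside the `K₂,₃`. If they are
distinct its boundary is a matching; if all agree the graph is `K₃,₃`; if exactly two agree, their
common value is absorbed as well. -/
theorem exists_isMatchingCut_of_K23 (h3 : G.IsThreeRegular) (hb : G.Bridgeless)
    (hK33 : ¬ Nonempty (G ≃g completeBipartiteGraph (Fin 3) (Fin 3)))
    (htri : ∀ a b c, G.Adj a b → G.Adj b c → ¬ G.Adj c a)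
    {a c x y z : V} (hac : a ≠ c) (hA : G.HasNeighbors a x y z) (hC : G.HasNeighbors c x y z) :
    ∃ A, G.IsMatchingCut A := by
  have hax : G.Adj a x := (hA.adj_iff x).2 (by simp)
  have hay : G.Adj a y := (hA.adj_iff y).2 (by simp)
  have haz : G.Adj a z := (hA.adj_iff z).2 (by simp)
  have hcx : G.Adj c x := (hC.adj_iff x).2 (by simp)
  have hcy : G.Adj c y := (hC.adj_iff y).2 (by simp)
  have hcz : G.Adj c z := (hC.adj_iff z).2 (by simp)
  have hxy : ¬ G.Adj x y := fun h ↦ htri a x y hax h hay.symm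
  have hyz : ¬ G.Adj y z := fun h ↦ htri a y z hay h haz.symm
  have hxz : ¬ G.Adj x z := fun h ↦ htri a x z hax h haz.symm
  obtain ⟨x', hX⟩ := h3.exists_third hax.symm hcx.symm hac
  obtain ⟨y', hY⟩ := h3.exists_third hay.symm hcy.symm hac
  obtain ⟨z', hZ⟩ := h3.exists_third haz.symm hcz.symm hac
  have hxx' : G.Adj x x' := (hX.adj_iff x').2 (by simp)
  have hyy' : G.Adj y y' := (hY.adj_iff y').2 (by simp)
  have hzz' : G.Adj z z' := (hZ.adj_iff z').2 (by simp)
  have hx'y : x' ≠ y := by rintro rfl; exact hxy hxx'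
  have hx'z : x' ≠ z := by rintro rfl; exact hxz hxx'
  have hy'x : y' ≠ x := by rintro rfl; exact hxy hyy'.symm
  have hy'z : y' ≠ z := by rintro rfl; exact hyz hyy'
  have hz'x : z' ≠ x := by rintro rfl; exact hxz hzz'.symm
  have hz'y : z' ≠ y := by rintro rfl; exact hyz hzz'.symm
  by_cases e₁ : x' = y'
  · subst e₁
    by_cases e₂ : z' = x'
    · subst e₂
      obtain ⟨t, hV⟩ := h3.exists_third hxx'.symm hyy'.symm hA.ne₁₂
      obtain rfl : z = t := by
        have := (hV.adj_iff z).1 hzz'.symm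
        have := hA.ne₁₃
        have := hA.ne₂₃
        grind
      exact absurd
        (nonempty_iso_completeBipartiteGraph_of_hasNeighbors hb hA hC hX hY hZ hV) hK33
    · exact exists_isMatchingCut_of_common h3 hb hA hC hX hY hZ e₂ hx'z hz'x hz'y
  by_cases e₂ : y' = z'
  · subst e₂
    exact exists_isMatchingCut_of_common h3 hb hA.rotate hC.rotate hY hZ hX e₁ hy'x hx'y hx'z
  by_cases e₃ : x' = z'
  · subst e₃
    exact exists_isMatchingCut_of_common h3 hb hA.rotate.rotate hC.rotate.rotate hZ hX hY
      (Ne.symm e₁) hx'y hy'z hy'x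
  have := hxx'.ne
  have := hyy'.ne
  have := hzz'.ne
  obtain ⟨ha₁, ha₂, ha₃, hA⟩ := hA
  obtain ⟨hc₁, hc₂, hc₃, hC⟩ := hC
  obtain ⟨hx₁, hx₂, hx₃, hX⟩ := hX
  obtain ⟨hy₁, hy₂, hy₃, hY⟩ := hY
  obtain ⟨hz₁, hz₂, hz₃, hZ⟩ := hZ
  refine ⟨{a, c, x, y, z}, ⟨a, by simp⟩, ⟨x', by grind⟩, ?_, ?_⟩
  · simp only [Set.mem_insert_iff, Set.mem_singleton_iff]
    rintro p (rfl | rfl | rfl | rfl | rfl) q hq r hr h h' <;> grind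
  · simp only [Set.mem_insert_iff, Set.mem_singleton_iff]
    rintro q hq p (rfl | rfl | rfl | rfl | rfl) r (rfl | rfl | rfl | rfl | rfl) h h' <;> grind

/-- Without triangles the square has no diagonals and consecutive corners have different outer
neighbours. Only opposite corners can share one, and then they are the small class of a `K₂,₃`. -/
theorem exists_isMatchingCut_of_square (h3 : G.IsThreeRegular) (hb : G.Bridgeless)
    (hK33 : ¬ Nonempty (G ≃g completeBipartiteGraph (Fin 3) (Fin 3)))
    (htri : ∀ a b c, G.Adj a b → G.Adj b c → ¬ G.Adj c a)
    {a b c d : V} (hac : a ≠ c) (hbd : b ≠ d) (hab : G.Adj a b) (hbc : G.Adj b c)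
    (hcd : G.Adj c d) (hda : G.Adj d a) : ∃ A, G.IsMatchingCut A := by
  obtain ⟨a', hA⟩ := h3.exists_third hab hda.symm hbd
  obtain ⟨b', hB⟩ := h3.exists_third hab.symm hbc hac
  obtain ⟨c', hC⟩ := h3.exists_third hbc.symm hcd hbd
  obtain ⟨d', hD⟩ := h3.exists_third hda hcd.symm hac
  by_cases e₁ : a' = c'
  · subst e₁
    exact exists_isMatchingCut_of_K23 h3 hb hK33 htri hac hA hC
  by_cases e₂ : b' = d'
  · subst e₂
    exact exists_isMatchingCut_of_K23 h3 hb hK33 htri hbd hB hD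
  have haa' : G.Adj a a' := (hA.adj_iff a').2 (by simp)
  have hbb' : G.Adj b b' := (hB.adj_iff b').2 (by simp)
  have hcc' : G.Adj c c' := (hC.adj_iff c').2 (by simp)
  have hdd' : G.Adj d d' := (hD.adj_iff d').2 (by simp)
  have n₁ : a' ≠ b' := by rintro rfl; exact htri _ _ _ hab hbb' haa'.symm
  have n₂ : b' ≠ c' := by rintro rfl; exact htri _ _ _ hbc hcc' hbb'.symm
  have n₃ : c' ≠ d' := by rintro rfl; exact htri _ _ _ hcd hdd' hcc'.symm
  have n₄ : d' ≠ a' := by rintro rfl; exact htri _ _ _ hda haa' hdd'.symm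
  have hnac : a' ≠ c := by rintro rfl; exact htri _ _ _ hab hbc haa'.symm
  have := haa'.ne
  obtain ⟨ha₁, ha₂, ha₃, hA⟩ := hA
  obtain ⟨hb₁, hb₂, hb₃, hB⟩ := hB
  obtain ⟨hc₁, hc₂, hc₃, hC⟩ := hC
  obtain ⟨hd₁, hd₂, hd₃, hD⟩ := hD
  refine ⟨{a, b, c, d}, ⟨a, by simp⟩, ⟨a', by grind⟩, ?_, ?_⟩
  · simp only [Set.mem_insert_iff, Set.mem_singleton_iff]
    rintro p (rfl | rfl | rfl | rfl) q hq r hr h h' <;> grind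
  · simp only [Set.mem_insert_iff, Set.mem_singleton_iff]
    rintro q hq p (rfl | rfl | rfl | rfl) r (rfl | rfl | rfl | rfl) h h' <;> grind

/-! ### Shortest cycles -/

/-- In an acyclic graph `xy` is a bridge, hence the whole boundary of the component of `x` left
after its deletion. -/
theorem Bridgeless.not_isAcyclic (hb : G.Bridgeless) {x y : V} (hxy : G.Adj x y) :
    ¬ G.IsAcyclic := by
  rw [isAcyclic_iff_forall_adj_isBridge]
  intro h
  have hbr := isBridge_iff.1 (h hxy)
  obtain ⟨u, hu, v, hv, huv, hne⟩ :=
    hb {z | (G.deleteEdges {s(x, y)}).Reachable x z} ⟨x, .refl _⟩ ⟨y, hbr⟩ x y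
  refine hv (Reachable.trans hu (Adj.reachable ?_))
  simpa [huv] using hne

theorem Walk.IsPath.girth_le_length_add_one {u v : V} {p : G.Walk u v} (hp : p.IsPath)
    (h : G.Adj v u) (he : s(v, u) ∉ p.edges) : G.girth ≤ p.length + 1 := by
  simpa using girth_le_length ((Walk.cons_isCycle_iff p h).2 ⟨hp, he⟩)

theorem Walk.IsPath.girth_le_length_add_two {u v w : V} {p : G.Walk u v} (hp : p.IsPath)
    (huv : u ≠ v) (hw : w ∉ p.support) (hwu : G.Adj w u) (hvw : G.Adj v w) :
    G.girth ≤ p.length + 2 := by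
  have := (hp.concat hw hvw).girth_le_length_add_one hwu (by
    rw [Walk.edges_concat, List.concat_eq_append, List.mem_append, List.mem_singleton]
    rintro (h | h)
    · exact hw (Walk.fst_mem_support_of_mem_edges _ h)
    · grind)
  simpa using this

theorem Walk.exists_adj_adj_of_length_eq_two {u v : V} (p : G.Walk u v) (h : p.length = 2) :
    ∃ x ∈ p.support, G.Adj u x ∧ G.Adj x v := by
  match p, h with
  | .cons h₁ (.cons h₂ .nil), _ => exact ⟨_, by simp, h₁, h₂⟩

/-- Two vertices on a shortest cycle with a common neighbour off the cycle have another common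
neighbour on it. -/
theorem exists_common_neighbor_of_shortest_cycle {u v w : V} {c : G.Walk u u} (hc : c.IsCycle)
    (hlen : G.girth = c.length) (hv : v ∈ c.support) (huv : u ≠ v) (hw : w ∉ c.support)
    (hwu : G.Adj w u) (hvw : G.Adj v w) : ∃ x ∈ c.support, G.Adj u x ∧ G.Adj x v := by
  classical
  have hspec := c.take_spec hv
  have hsub₁ := c.support_takeUntil_subset_support hv
  have hsub₂ := c.support_dropUntil_subset_support hv
  generalize c.takeUntil v hv = p at hspec hsub₁
  generalize c.dropUntil v hv = q at hspec hsub₂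
  have hp : p.IsPath := (hspec ▸ hc).isPath_of_append_left (Walk.not_nil_of_ne huv.symm)
  have hq : q.IsPath := (hspec ▸ hc).isPath_of_append_right (Walk.not_nil_of_ne huv)
  have h₁ := hp.girth_le_length_add_two huv (fun h ↦ hw (hsub₁ h)) hwu hvw
  have h₂ := hq.girth_le_length_add_two huv.symm (fun h ↦ hw (hsub₂ h)) hvw.symm hwu.symm
  have h₃ := hc.three_le_length
  have h₄ : p.length + q.length = c.length := by rw [← hspec, Walk.length_append]
  -- Each arc is at least the girth minus two, and they sum to the girth; so both have length at
  -- most 2, with sum at least 3.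
  rcases (by omega : p.length = 2 ∨ q.length = 2) with h | h
  · obtain ⟨x, hx, h⟩ := p.exists_adj_adj_of_length_eq_two h
    exact ⟨x, hsub₁ hx, h⟩
  · obtain ⟨x, hx, h, h'⟩ := q.exists_adj_adj_of_length_eq_two h
    exact ⟨x, hsub₂ hx, h'.symm, h.symm⟩

/-- A shortest cycle has no chords. -/
theorem adj_toSubgraph_of_shortest_cycle {u v : V} {c : G.Walk u u} (hc : c.IsCycle)
    (hlen : G.girth = c.length) (hv : v ∈ c.support) (h : G.Adj u v) :
    c.toSubgraph.Adj u v := by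
  classical
  rw [Walk.adj_toSubgraph_iff_mem_edges]
  have huv := h.ne
  have hspec := c.take_spec hv
  generalize c.takeUntil v hv = p at hspec
  generalize c.dropUntil v hv = q at hspec
  have hp : p.IsPath := (hspec ▸ hc).isPath_of_append_left (Walk.not_nil_of_ne huv.symm)
  have h₄ : p.length + q.length = c.length := by rw [← hspec, Walk.length_append]
  rw [← hspec, Walk.edges_append, List.mem_append]
  by_contra! hcon
  have h₁ := hp.girth_le_length_add_one h.symm (by rw [Sym2.eq_swap]; exact hcon.1)
  -- The chord closes `p` into a cycle, so `q` has length at most 1 and is the supposed chord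
  -- itself.
  have hq : q.length = 1 := by
    have : q.length ≠ 0 := fun h0 ↦ huv (Walk.eq_of_length_eq_zero h0).symm
    omega
  match q, hq with
  | .cons h₁ .nil, _ => exact hcon.2 (by simp [Sym2.eq_swap])

/-- A cubic bridgeless graph without cycles of length four has a matching cut, the
boundary of a shortest cycle. -/
theorem exists_isMatchingCut_of_no_square [Nonempty V] (h3 : G.IsThreeRegular)
    (hb : G.Bridgeless)
    (hsq : ∀ a b c d, a ≠ c → b ≠ d → G.Adj a b → G.Adj b c → G.Adj c d → ¬ G.Adj d a) :
    ∃ A, G.IsMatchingCut A := by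
  classical
  obtain ⟨r⟩ := ‹Nonempty V›
  obtain ⟨r₁, _, _, hr⟩ := h3 r
  obtain ⟨u, c, hc, hlen⟩ := exists_girth_eq_length.2
    (hb.not_isAcyclic ((hr.adj_iff r₁).2 (by simp)))
  have hnb : ∀ x ∈ c.support, ∃ y z t, G.HasNeighbors x y z t ∧
      y ∈ c.support ∧ z ∈ c.support ∧ t ∉ c.support := by
    intro x hx
    obtain ⟨y, z, hyz, hset⟩ := Set.ncard_eq_two.1 (hc.ncard_neighborSet_toSubgraph_eq_two hx)
    have hy : c.toSubgraph.Adj x y := by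
      change y ∈ c.toSubgraph.neighborSet x
      simp [hset]
    have hz : c.toSubgraph.Adj x z := by
      change z ∈ c.toSubgraph.neighborSet x
      simp [hset]
    obtain ⟨t, ht⟩ := h3.exists_third hy.adj_sub hz.adj_sub hyz
    refine ⟨y, z, t, ht, c.mem_verts_toSubgraph.1 hy.snd_mem,
      c.mem_verts_toSubgraph.1 hz.snd_mem, fun hts ↦ ?_⟩
    have hadj : c.toSubgraph.Adj x t := by
      have := adj_toSubgraph_of_shortest_cycle (hc.rotate hx) (by simpa using hlen)
        (v := t) (by simpa using hts) ((ht.adj_iff t).2 (by simp))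
      simpa using this
    have hm : t ∈ c.toSubgraph.neighborSet x := hadj
    rw [hset] at hm
    have := ht.ne₁₃
    have := ht.ne₂₃
    grind
  refine ⟨{x | x ∈ c.support}, ⟨u, c.start_mem_support⟩, ?_, ?_, ?_⟩
  · obtain ⟨_, _, t, _, _, _, ht⟩ := hnb u c.start_mem_support
    exact ⟨t, ht⟩
  · intro x hx y hy z hz hxy hxz
    obtain ⟨p, q, t, ⟨-, -, -, hn⟩, hp, hq, ht⟩ := hnb x hx
    simp only [Set.mem_ofPred_eq] at hy hz
    grind
  · intro y hy x hx z hz hxy hzy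
    by_contra hne
    -- The vertices `x`, `t`, `z` on the cycle and `y` off it form a forbidden square.
    obtain ⟨t, ht, hxt, htz⟩ := exists_common_neighbor_of_shortest_cycle (hc.rotate hx)
      (by simpa using hlen) (v := z) (w := y) (by simpa using hz) hne (by simpa using hy)
      hxy.symm hzy
    refine hsq x t z y hne ?_ hxt htz hzy hxy.symm
    rintro rfl
    exact hy (by simpa using ht)

theorem exists_isMatchingCut [Nonempty V] (h3 : G.IsThreeRegular) (hb : G.Bridgeless)
    (hK4 : ¬ Nonempty (G ≃g (⊤ : SimpleGraph (Fin 4))))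
    (hK33 : ¬ Nonempty (G ≃g completeBipartiteGraph (Fin 3) (Fin 3))) :
    ∃ A, G.IsMatchingCut A := by
  by_contra hcon
  have htri : ∀ a b c, G.Adj a b → G.Adj b c → ¬ G.Adj c a := fun a b c h₁ h₂ h₃ ↦
    hcon (exists_isMatchingCut_of_triangle h3 hb hK4 h₁ h₂ h₃)
  exact hcon (exists_isMatchingCut_of_no_square h3 hb
    fun a b c d hac hbd h₁ h₂ h₃ h₄ ↦
      hcon (exists_isMatchingCut_of_square h3 hb hK33 htri hac hbd h₁ h₂ h₃ h₄))

end SimpleGraph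

/-! ### Cuts and components in multigraphs -/

namespace Graph

variable {α β : Type*} {H : Graph α β}

theorem Reachable.mem_of_closed {A : Set α} (hA : ∀ x ∈ A, ∀ y, H.Adj x y → y ∈ A) {x y : α}
    (h : H.Reachable x y) (hx : x ∈ A) : y ∈ A := by
  induction h with
  | refl => exact hx
  | tail _ h ih => exact hA _ ih _ h

/-- Every edge boundary in a 2-edge-connected graph contains an edge other than a given one. -/
theorem IsEdgeConnected.exists_crossing (hH : H.IsEdgeConnected 2) {A : Set α} {a b : α}
    (ha : a ∈ A) (haV : a ∈ V(H)) (hb : b ∉ A) (hbV : b ∈ V(H)) (e : β) :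
    ∃ f ≠ e, ∃ x ∈ A, ∃ y ∉ A, H.IsLink f x y := by
  by_contra! hcon
  -- The label `e` need not be an edge of `H`, while only sets of edges may be deleted.
  have hF : ({e} ∩ E(H)).encard < ((2 : ℕ) : ℕ∞) :=
    (Set.encard_le_encard Set.inter_subset_left).trans_lt (by simp)
  have hr := (hH.2 _ Set.inter_subset_right hF).2 a haV b hbV
  refine hb (hr.mem_of_closed (fun x hx y hxy ↦ ?_) ha)
  obtain ⟨f, hf⟩ := hxy
  simp only [deleteEdges_isLink, Set.mem_inter_iff, Set.mem_singleton_iff, not_and] at hf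
  by_contra hy
  exact hcon f (fun hfe ↦ hf.2 hfe hf.1.edge_mem) x hx y hy hf.1

theorem IsEdgeConnected.isConnected (hH : H.IsEdgeConnected 2) : H.IsConnected := by
  simpa using hH.2 ∅ (by simp) (by simp)

theorem IsConnected.components_encard_le_one (hH : H.IsConnected) :
    H.components.encard ≤ 1 := by
  rw [Set.encard_le_one_iff]
  rintro _ _ ⟨x, hx, rfl⟩ ⟨y, hy, rfl⟩
  ext z
  exact ⟨fun h ↦ (hH.2 y hy x hx).trans h, fun h ↦ (hH.2 x hx y hy).trans h⟩

/-- A set of vertices whose boundary edges are pairwise non-adjacent gives a separating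
matching. -/
theorem IsConnected.isDecomposable_of_cut (hH : H.IsConnected) {A : Set α} {a b : α}
    (ha : a ∈ A) (haV : a ∈ V(H)) (hb : b ∉ A) (hbV : b ∈ V(H))
    (hright : ∀ e f x y z, x ∈ A → y ∉ A → z ∉ A → H.IsLink e x y → H.IsLink f x z → e = f)
    (hleft : ∀ e f x y z, x ∉ A → y ∈ A → z ∈ A → H.IsLink e x y → H.IsLink f x z → e = f) :
    H.IsDecomposable := by
  refine ⟨{e | ∃ x ∈ A, ∃ y ∉ A, H.IsLink e x y}, ⟨?_, ?_, ?_⟩, ?_⟩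
  · rintro e ⟨x, -, y, -, h⟩
    exact h.edge_mem
  · rintro e ⟨x, hx, y, hy, h⟩ z hz
    have h₁ := hz.eq_of_inc h.inc_left
    have h₂ := hz.eq_of_inc h.inc_right
    exact hy (h₂ ▸ h₁ ▸ hx)
  · rintro e ⟨x, hx, y, hy, h⟩ f ⟨x', hx', y', hy', h'⟩ z hez hfz
    rcases hez.eq_or_eq_of_isLink h with rfl | rfl <;>
      rcases hfz.eq_or_eq_of_isLink h' with rfl | rfl
    · exact hright _ _ _ _ _ hx hy hy' h h'
    · exact absurd hx hy'
    · exact absurd hx' hy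
    · exact hleft _ _ _ _ _ hy hx hx' h.symm h'.symm
  -- After deletion no edge leaves `A`, so `a` and `b` lie in different components.
  · refine hH.components_encard_le_one.trans_lt (Set.one_lt_encard_iff.2
      ⟨_, _, ⟨a, haV, rfl⟩, ⟨b, hbV, rfl⟩, fun heq ↦ ?_⟩)
    have hab : b ∈ {y | (H.deleteEdges {e | ∃ x ∈ A, ∃ y ∉ A, H.IsLink e x y}).Reachable a y} :=
      heq ▸ Relation.ReflTransGen.refl
    refine hb (Reachable.mem_of_closed (fun x hx y hxy ↦ ?_) hab ha)
    obtain ⟨e, he⟩ := hxy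
    rw [deleteEdges_isLink] at he
    by_contra hy
    exact he.2 ⟨x, hx, y, hy, he.1⟩

/-! ### Loops and parallel edges -/

/-- At least two edges leave the vertex, and a loop there counts twice, giving degree at least 4. -/
theorem IsCubic.loopless (hc : H.IsCubic) (hH : H.IsEdgeConnected 2) : H.Loopless := by
  refine ⟨fun e x he ↦ ?_⟩
  have hx := he.vertex_mem
  obtain ⟨y, hy, hyx⟩ := hH.1.exists_ne x
  obtain ⟨f, -, x', hx', p, hp, hf⟩ := hH.exists_crossing (A := {x}) rfl hx (by simpa using hyx) hy e
  obtain rfl : x' = x := hx'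
  obtain ⟨g, hgf, z, hz, q, hq, hg⟩ :=
    hH.exists_crossing (A := {x'}) rfl hx (by simpa using hyx) hy f
  obtain rfl : z = x' := hz
  have hef : e ≠ f := by
    rintro rfl
    exact hp (he.eq_of_inc hf.inc_right).symm
  have heg : e ≠ g := by
    rintro rfl
    exact hq (he.eq_of_inc hg.inc_right).symm
  have h₁ : ({e, f, g} : Set β).encard ≤ (H.incidenceSet z).encard := by
    refine Set.encard_le_encard ?_
    rintro _ (rfl | rfl | rfl)
    exacts [he.inc, hf.inc_left, hg.inc_left]
  have h₂ : (1 : ℕ∞) ≤ (H.loopSet z).encard := Set.one_le_encard_iff_nonempty.2 ⟨e, he⟩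
  rw [Set.encard_eq_three.2 ⟨e, f, g, hef, heg, hgf.symm, rfl⟩] at h₁
  have h₃ := add_le_add h₁ h₂
  have h₄ := hc z hx
  rw [edegree] at h₄
  rw [h₄] at h₃
  exact absurd h₃ (by decide)

theorem IsCubic.exists_incident [H.Loopless] (hc : H.IsCubic) {x : α} (hx : x ∈ V(H)) :
    ∃ e f g, e ≠ f ∧ e ≠ g ∧ f ≠ g ∧ ∀ d, H.Inc d x ↔ d = e ∨ d = f ∨ d = g := by
  have h := hc x hx
  have h0 : H.loopSet x = ∅ := by ext; simp
  rw [edegree, h0, Set.encard_empty, add_zero] at h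
  obtain ⟨e, f, g, h₁, h₂, h₃, hs⟩ := Set.encard_eq_three.1 h
  refine ⟨e, f, g, h₁, h₂, h₃, fun d ↦ ?_⟩
  rw [← mem_incidenceSet, hs]
  simp

theorem IsCubic.exists_third [H.Loopless] (hc : H.IsCubic) {x : α} {e f : β} (he : H.Inc e x)
    (hf : H.Inc f x) (hef : e ≠ f) :
    ∃ g, g ≠ e ∧ g ≠ f ∧ ∀ d, H.Inc d x ↔ d = e ∨ d = f ∨ d = g := by
  obtain ⟨p, q, r, h₁, h₂, h₃, hn⟩ := hc.exists_incident he.vertex_mem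
  rcases (hn e).1 he with rfl | rfl | rfl <;> rcases (hn f).1 hf with rfl | rfl | rfl
  · exact absurd rfl hef
  · exact ⟨r, by grind⟩
  · exact ⟨q, by grind⟩
  · exact ⟨r, by grind⟩
  · exact absurd rfl hef
  · exact ⟨p, by grind⟩
  · exact ⟨q, by grind⟩
  · exact ⟨p, by grind⟩
  · exact absurd rfl hef

/-- The maps run from the model `K` into `H`, so that they can be given by explicit lists of
vertices and edges. -/
theorem isIsomorphic_of_bijOn {α' β' : Type*} {K : Graph α' β'} {φ : α' → α} {ψ : β' → β}
    (hφ : Set.BijOn φ V(K) V(H)) (hψ : Set.BijOn ψ E(K) E(H))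
    (h : ∀ e ∈ E(K), ∀ x ∈ V(K), ∀ y ∈ V(K), H.IsLink (ψ e) (φ x) (φ y) ↔ K.IsLink e x y) :
    H.IsIsomorphic K := by
  refine ⟨(hφ.equiv φ).symm, (hψ.equiv ψ).symm, fun d x y ↦ ?_⟩
  obtain ⟨d, rfl⟩ := (hψ.equiv ψ).surjective d
  obtain ⟨x, rfl⟩ := (hφ.equiv φ).surjective x
  obtain ⟨y, rfl⟩ := (hφ.equiv φ).surjective y
  simp only [Equiv.symm_apply_apply]
  exact h d d.2 x x.2 y y.2

theorem isIsomorphic_S2 {a b : α} {e f g : β} (hab : a ≠ b) (hV : ∀ x ∈ V(H), x = a ∨ x = b)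
    (hef : e ≠ f) (heg : e ≠ g) (hfg : f ≠ g) (he : H.IsLink e a b) (hf : H.IsLink f a b)
    (hg : H.IsLink g a b) (hE : ∀ d ∈ E(H), d = e ∨ d = f ∨ d = g) : H.IsIsomorphic S2 := by
  have hlink : ∀ i : Fin 3, H.IsLink (![e, f, g] i) a b := by
    intro i
    fin_cases i
    exacts [he, hf, hg]
  refine isIsomorphic_of_bijOn (φ := ![a, b]) (ψ := ![e, f, g]) ⟨?_, ?_, ?_⟩ ⟨?_, ?_, ?_⟩ ?_
  · intro i _
    fin_cases i
    exacts [he.left_mem, he.right_mem]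
  · intro i _ j _ hij
    fin_cases i <;> fin_cases j <;> simp_all
  · intro x hx
    rcases hV x hx with rfl | rfl
    exacts [⟨0, by simp [S2], rfl⟩, ⟨1, by simp [S2], rfl⟩]
  · intro i _
    exact (hlink i).edge_mem
  · intro i _ j _ hij
    fin_cases i <;> fin_cases j <;> simp_all
  · intro d hd
    rcases hE d hd with rfl | rfl | rfl
    exacts [⟨0, by simp [S2], rfl⟩, ⟨1, by simp [S2], rfl⟩, ⟨2, by simp [S2], rfl⟩]
  · intro i _ j _ k _
    rw [(hlink i).isLink_iff]
    fin_cases j <;> fin_cases k <;> simp [S2, hab, hab.symm]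

/-- A pair of parallel edges in a cubic 2-edge-connected graph gives a separating matching, unless
the graph is `S₂`. -/
theorem IsCubic.isDecomposable_of_parallel [H.Loopless] (hc : H.IsCubic)
    (hH : H.IsEdgeConnected 2) (hS2 : ¬ H.IsIsomorphic S2) {a b : α} {e f : β} (hef : e ≠ f)
    (he : H.IsLink e a b) (hf : H.IsLink f a b) : H.IsDecomposable := by
  have hab := he.ne
  obtain ⟨g, hge, hgf, hga⟩ := hc.exists_third he.inc_left hf.inc_left hef
  obtain ⟨h, hhe, hhf, hhb⟩ := hc.exists_third he.inc_right hf.inc_right hef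
  obtain ⟨a', hg⟩ := (hga g).2 (by simp)
  obtain ⟨b', hh⟩ := (hhb h).2 (by simp)
  -- If the third edges coincide, no edge leaves `{a, b}` and the graph is `S₂`.
  by_cases hgh : g = h
  · subst hgh
    obtain rfl : a' = b := by
      have := hh.eq_and_eq_or_eq_and_eq hg
      grind
    have hV : ∀ x ∈ V(H), x = a ∨ x = a' := by
      intro x hx
      by_contra hcon
      obtain ⟨d, -, y, hy, z, hz, hd⟩ := hH.exists_crossing (A := {a, a'}) (by simp) he.left_mem
        (b := x) (by simpa using hcon) hx e
      have hdd : d = e ∨ d = f ∨ d = g := by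
        rcases hy with rfl | rfl
        exacts [(hga d).1 hd.inc_left, (hhb d).1 hd.inc_left]
      have : z = a ∨ z = a' := by
        rcases hdd with rfl | rfl | rfl
        exacts [hd.inc_right.eq_or_eq_of_isLink he, hd.inc_right.eq_or_eq_of_isLink hf,
          hd.inc_right.eq_or_eq_of_isLink hg]
      exact hz (by simpa using this)
    refine absurd (isIsomorphic_S2 hab hV hef hge.symm hgf.symm he hf hg fun d hd ↦ ?_) hS2
    obtain ⟨y, z, hyz⟩ := exists_isLink_of_mem_edgeSet hd
    rcases hV y hyz.left_mem with rfl | rfl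
    · exact (hga d).1 hyz.inc_left
    · exact (hhb d).1 hyz.inc_left
  · have ha'b : a' ≠ b := by
      rintro rfl
      have := (hhb g).1 hg.inc_right
      grind
    have hb'a : b' ≠ a := by
      rintro rfl
      have := (hga h).1 hh.inc_right
      grind
    have ha'a := hg.ne
    have hb'b := hh.ne
    have hcross : ∀ d x y, x ∈ ({a, b} : Set α) → y ∉ ({a, b} : Set α) → H.IsLink d x y →
        (d = g ∧ x = a ∧ y = a') ∨ (d = h ∧ x = b ∧ y = b') := by
      intro d x y hx hy hd
      have hyab : ¬ (y = a ∨ y = b) := by simpa using hy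
      have hde : d ≠ e := fun h ↦ hyab ((h ▸ hd.inc_right).eq_or_eq_of_isLink he)
      have hdf : d ≠ f := fun h ↦ hyab ((h ▸ hd.inc_right).eq_or_eq_of_isLink hf)
      rcases hx with rfl | rfl
      · obtain rfl : d = g := by have := (hga d).1 hd.inc_left; tauto
        exact .inl ⟨rfl, rfl, hd.right_unique hg⟩
      · obtain rfl : d = h := by have := (hhb d).1 hd.inc_left; tauto
        exact .inr ⟨rfl, rfl, hd.right_unique hh⟩
    by_cases hw : a' = b'
    · subst hw
      obtain ⟨k, hkg, hkh, hk⟩ := hc.exists_third hg.inc_right hh.inc_right hgh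
      obtain ⟨t, ht⟩ := (hk k).2 (by simp)
      have hta' := ht.ne
      have htab : t ∉ ({a, b} : Set α) := fun htm ↦ by
        have := hcross k t a' htm (by grind) ht.symm
        grind
      -- If both leaving edges end at `a'`, its third edge `k` would be a bridge.
      obtain ⟨d, hdk, x, hx, y, hy, hd⟩ := hH.exists_crossing (A := insert a' {a, b}) (a := a)
        (b := t) (by simp) he.left_mem (by grind) ht.right_mem k
      rcases hx with rfl | hx
      · have hd' := (hk d).1 hd.inc_left
        have h₁ : d = g → y = a := by rintro rfl; exact hd.right_unique hg.symm
        have h₂ : d = h → y = b := by rintro rfl; exact hd.right_unique hh.symm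
        grind
      · have := hcross d x y hx (by grind) hd
        grind
    · refine hH.isConnected.isDecomposable_of_cut (A := {a, b}) (a := a) (b := a') (by simp)
        he.left_mem (by grind) hg.right_mem ?_ ?_
      · intro d d' x y z hx hy hz hd hd'
        have := hcross d x y hx hy hd
        have := hcross d' x z hx hz hd'
        grind
      · intro d d' x y z hx hy hz hd hd'
        have := hcross d y x hy hx hd.symm
        have := hcross d' z x hz hx hd'.symm
        grind

/-! ### Passing between simple multigraphs and `SimpleGraph` -/

/-- Without parallel edges an edge is determined by its ends, so the vertex bijection induces the
edge bijection. -/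
theorem isIsomorphic_ofSimpleGraph [H.Simple] {V : Type*} {K : SimpleGraph V}
    (φ : H.toSimpleGraph ≃g K) : H.IsIsomorphic (ofSimpleGraph K) := by
  have hex : ∀ e : E(H), ∃ s : E(ofSimpleGraph K),
      ∀ x y : V(H), H.IsLink e x y ↔ s.1 = s(φ x, φ y) := by
    rintro ⟨e, he⟩
    obtain ⟨x, y, hxy⟩ := exists_isLink_of_mem_edgeSet he
    refine ⟨⟨s(φ ⟨x, hxy.left_mem⟩, φ ⟨y, hxy.right_mem⟩), ?_⟩, fun u v ↦ ?_⟩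
    · exact φ.map_rel_iff.2 ((toSimpleGraph_adj_iff _ _).2 hxy.adj)
    · rw [hxy.isLink_iff]
      simp [Subtype.ext_iff]
  choose ψ hψ using hex
  have hbij : Function.Bijective ψ := by
    constructor
    · intro e f hef
      obtain ⟨x, y, hxy⟩ := exists_isLink_of_mem_edgeSet e.2
      have h₁ := (hψ e ⟨x, hxy.left_mem⟩ ⟨y, hxy.right_mem⟩).1 hxy
      have h₂ := (hψ f ⟨x, hxy.left_mem⟩ ⟨y, hxy.right_mem⟩).2 (hef ▸ h₁)
      exact Subtype.ext (hxy.eq h₂)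
    · rintro ⟨s, hs⟩
      induction s with | h u v
      have hadj : H.toSimpleGraph.Adj (φ.symm u) (φ.symm v) := φ.symm.map_rel_iff.2 hs
      obtain ⟨e, he⟩ := (toSimpleGraph_adj_iff _ _).1 hadj
      refine ⟨⟨e, he.edge_mem⟩, Subtype.ext ?_⟩
      simpa using (hψ ⟨e, he.edge_mem⟩ _ _).1 he
  refine ⟨φ.toEquiv.trans (Equiv.Set.univ V).symm, Equiv.ofBijective ψ hbij, fun e x y ↦ ?_⟩
  rw [hψ]
  exact ⟨fun h ↦ ⟨h, (ψ e).2⟩, fun h ↦ h.1⟩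

theorem IsCubic.isThreeRegular [H.Simple] (hc : H.IsCubic) :
    H.toSimpleGraph.IsThreeRegular := by
  rintro ⟨x, hx⟩
  obtain ⟨e, f, g, h₁, h₂, h₃, hn⟩ := hc.exists_incident hx
  obtain ⟨a, ha⟩ := (hn e).2 (by simp)
  obtain ⟨b, hb⟩ := (hn f).2 (by simp)
  obtain ⟨c, hc⟩ := (hn g).2 (by simp)
  refine ⟨⟨a, ha.right_mem⟩, ⟨b, hb.right_mem⟩, ⟨c, hc.right_mem⟩, ?_, ?_, ?_, ?_⟩
  · simp only [ne_eq, Subtype.mk.injEq]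
    rintro rfl
    exact h₁ (ha.eq hb)
  · simp only [ne_eq, Subtype.mk.injEq]
    rintro rfl
    exact h₂ (ha.eq hc)
  · simp only [ne_eq, Subtype.mk.injEq]
    rintro rfl
    exact h₃ (hb.eq hc)
  · rintro ⟨y, hy⟩
    simp only [toSimpleGraph_adj_iff, Subtype.mk.injEq]
    constructor
    · rintro ⟨d, hd⟩
      rcases (hn d).1 hd.inc_left with rfl | rfl | rfl
      exacts [.inl (hd.right_unique ha), .inr (.inl (hd.right_unique hb)),
        .inr (.inr (hd.right_unique hc))]
    · rintro (rfl | rfl | rfl)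
      exacts [ha.adj, hb.adj, hc.adj]

theorem IsEdgeConnected.bridgeless [H.Simple] (hH : H.IsEdgeConnected 2) :
    H.toSimpleGraph.Bridgeless := by
  rintro A ⟨⟨a, haV⟩, ha⟩ ⟨⟨b, hbV⟩, hb⟩ u v
  have hmem : ∀ x : V(H), x.1 ∈ Subtype.val '' A ↔ x ∈ A := fun x ↦ by simp
  have key : ∀ e, ∃ f ≠ e, ∃ x ∈ A, ∃ y ∉ A, H.IsLink f x y := by
    intro e
    obtain ⟨f, hf, x, hx, y, hy, h⟩ := hH.exists_crossing ((hmem ⟨a, haV⟩).2 ha) haV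
      (mt (hmem ⟨b, hbV⟩).1 hb) hbV e
    exact ⟨f, hf, ⟨x, h.left_mem⟩, (hmem ⟨x, h.left_mem⟩).1 hx, ⟨y, h.right_mem⟩,
      mt (hmem ⟨y, h.right_mem⟩).2 hy, h⟩
  by_cases huv : H.Adj u v
  · obtain ⟨e, he⟩ := huv
    obtain ⟨f, hf, x, hx, y, hy, h⟩ := key e
    refine ⟨x, hx, y, hy, (toSimpleGraph_adj_iff _ _).2 h.adj, fun hs ↦ hf ?_⟩
    rcases Sym2.eq_iff.1 hs with ⟨rfl, rfl⟩ | ⟨rfl, rfl⟩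
    exacts [h.eq he, h.eq he.symm]
  -- A nonadjacent pair excludes no edge, but `key` still needs some label; one exists because `a`
  -- reaches `b`.
  · obtain ⟨e⟩ : Nonempty β := by
      by_contra hβ
      have hr := hH.isConnected.2 a haV b hbV
      refine mt (hmem ⟨b, hbV⟩).1 hb
        (hr.mem_of_closed (fun x _ y ⟨e, _⟩ ↦ (hβ ⟨e⟩).elim) ((hmem ⟨a, haV⟩).2 ha))
    obtain ⟨f, -, x, hx, y, hy, h⟩ := key e
    refine ⟨x, hx, y, hy, (toSimpleGraph_adj_iff _ _).2 h.adj, fun hs ↦ huv ?_⟩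
    rcases Sym2.eq_iff.1 hs with ⟨rfl, rfl⟩ | ⟨rfl, rfl⟩
    exacts [h.adj, h.adj.symm]

theorem IsConnected.isDecomposable_of_isMatchingCut [H.Simple] (hH : H.IsConnected)
    {A : Set V(H)} (hA : H.toSimpleGraph.IsMatchingCut A) : H.IsDecomposable := by
  obtain ⟨⟨⟨a, haV⟩, ha⟩, ⟨⟨b, hbV⟩, hb⟩, hr, hl⟩ := hA
  have hmem : ∀ x : V(H), x.1 ∈ Subtype.val '' A ↔ x ∈ A := fun x ↦ by simp
  refine hH.isDecomposable_of_cut ((hmem ⟨a, haV⟩).2 ha) haV (mt (hmem ⟨b, hbV⟩).1 hb) hbV ?_ ?_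
  · intro e f x y z hx hy hz he hf
    have := hr ⟨x, he.left_mem⟩ ((hmem _).1 hx) ⟨y, he.right_mem⟩ (mt (hmem _).2 hy)
      ⟨z, hf.right_mem⟩ (mt (hmem _).2 hz) ((toSimpleGraph_adj_iff _ _).2 he.adj)
      ((toSimpleGraph_adj_iff _ _).2 hf.adj)
    obtain rfl : y = z := congrArg Subtype.val this
    exact he.eq hf
  · intro e f x y z hx hy hz he hf
    have := hl ⟨x, he.left_mem⟩ (mt (hmem _).2 hx) ⟨y, he.right_mem⟩ ((hmem _).1 hy)
      ⟨z, hf.right_mem⟩ ((hmem _).1 hz) ((toSimpleGraph_adj_iff _ _).2 he.adj.symm)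
      ((toSimpleGraph_adj_iff _ _).2 hf.adj.symm)
    obtain rfl : y = z := congrArg Subtype.val this
    exact he.eq hf

end Graph

theorem mainTheorem6 {α β : Type*} (H : Graph α β)
    (hfin : V(H).Finite) (hcubic : H.IsCubic) (hconn : H.IsEdgeConnected 2)
    (hS2 : ¬ H.IsIsomorphic Graph.S2)
    (hK4 : ¬ H.IsIsomorphic Graph.K4)
    (hK33 : ¬ H.IsIsomorphic Graph.K33) :
    H.IsDecomposable := by
  have hloop := hcubic.loopless hconn
  by_cases hpar : ∃ e f a b, e ≠ f ∧ H.IsLink e a b ∧ H.IsLink f a b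
  · obtain ⟨e, f, a, b, hef, he, hf⟩ := hpar
    exact hcubic.isDecomposable_of_parallel hconn hS2 hef he hf
  push Not at hpar
  have hsimple : H.Simple :=
    ⟨fun e f x y he hf ↦ by_contra fun hef ↦ hpar e f x y hef he hf⟩
  have : Nonempty V(H) := hconn.1.nonempty.to_subtype
  obtain ⟨A, hA⟩ := SimpleGraph.exists_isMatchingCut hcubic.isThreeRegular hconn.bridgeless
    (fun ⟨φ⟩ ↦ hK4 (Graph.isIsomorphic_ofSimpleGraph φ))
    (fun ⟨φ⟩ ↦ hK33 (Graph.isIsomorphic_ofSimpleGraph φ))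
  exact hconn.isConnected.isDecomposable_of_isMatchingCut hA
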